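/- Let $\Omega\subset\mathbb R^2$ be a bounded open set, $X=H^1_0(\Omega)^2$, $Q=L^2_0(\Omega)$. Let $\|\cdot\|$ and $(\cdot,\cdot)$ be the $L^2(\Omega)$ norm and inner product of scalars, vectors and tensors, let $$b^*(u,v,w)=\tfrac12(u\cdot\nabla v,w)-\tfrac12(u\cdot\nabla w,v),$$ and for a bounded linear functional $f$ on $X$, whose value at $v$ is written $(f,v)$, let $\|f\|_{-1}=\sup_{0\ne v\in X}(f,v)/\|\nabla v\|$. For every constant $C_{\rm inv}$ there is a constant $C>0$, depending only on $\Omega$ and $C_{\rm inv}$, such that the following holds. Let $h>0$, and let $X_h\subset X$, $Q_h\subset Q$ be (finite element) subspaces satisfying the inverse inequality $h\|\nabla v_h\|\le C_{\rm inv}\|v_h\|$ for all $v_h\in X_h$. Let $\nu>0$, $\Delta t>0$, $J\ge1$, $N>2$, let $f_j^n$ be bounded linear functionals on $X$, and let $u_{j,h}^n\in X_h$ $(0\le n\le N)$ and $p_{j,h}^n\in Q_h$ $(3\le n\le N)$, $j=1,\dots,J$. Write $$\langle u_h\rangle^n=\frac1J\sum_{j=1}^J\left(3u_{j,h}^n-3u_{j,h}^{n-1}+u_{j,h}^{n-2}\right),\qquad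 u_{j,h}'^{\,n}=3u_{j,h}^n-3u_{j,h}^{n-1}+u_{j,h}^{n-2}-\langle u_h\rangle^n .$$ Suppose that for all $2\le n\le N-1$ and $j=1,\dots,J$ $$\Big(\tfrac{10u_{j,h}^{n+1}-15u_{j,h}^n+6u_{j,h}^{n-1}-u_{j,h}^{n-2}}{6\Delta t},v_h\Big)+b^*(\langle u_h\rangle^n,u_{j,h}^{n+1},v_h)+b^*(u_{j,h}'^{\,n},3u_{j,h}^n-3u_{j,h}^{n-1}+u_{j,h}^{n-2},v_h)-(p_{j,h}^{n+1},\nabla\cdot v_h)+\nu(\nabla u_{j,h}^{n+1},\nabla v_h)=(f_j^{n+1},v_h)\quad\forall v_h\in X_h,$$ $$(\nabla\cdot u_{j,h}^{n+1},q_h)=0\quad\forall q_h\in Q_h,$$ and that the time-step conditions $$C\,\frac{\Delta t}{\nu h}\left(\|u_{j,h}'^{\,n}\|_{L^4}+\|\nabla\cdot u_{j,h}'^{\,n}\|\right)^2\le 1,\qquad j=1,\dots,J,\quad 2\le n\le N-1,$$ hold. Then, for every $j=1,\dots,J$, $$\frac1{12}\|u_{j,h}^N\|^2+\frac1{12}\|3u_{j,h}^N-u_{j,h}^{N-1}\|^2+\frac1{12}\|3u_{j,h}^N-3u_{j,h}^{N-1}+u_{j,h}^{N-2}\|^2+\frac1{24}\sum_{n=2}^{N-1}\|u_{j,h}^{n+1}-3u_{j,h}^n+3u_{j,h}^{n-1}-u_{j,h}^{n-2}\|^2+\frac{\Delta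 t}4\sum_{n=2}^{N-1}\nu\|\nabla u_{j,h}^{n+1}\|^2$$ $$\le\sum_{n=2}^{N-1}\frac{\Delta t}\nu\|f_j^{n+1}\|_{-1}^2+\frac1{12}\|u_{j,h}^2\|^2+\frac1{12}\|3u_{j,h}^2-u_{j,h}^1\|^2+\frac1{12}\|3u_{j,h}^2-3u_{j,h}^1+u_{j,h}^0\|^2 .$$ -/

import Mathlib

open MeasureTheory
open scoped ContDiff

noncomputable section

namespace EnsembleNS

/-- The Euclidean plane (points of the domain and values of velocity fields). -/
abbrev Plane := EuclideanSpace ℝ (Fin 2)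

/-- `2 × 2` tensors with the Frobenius norm; the entry `(i, k)` of a velocity gradient
is the derivative of the `i`-th component in the direction `k`. -/
abbrev Tensor := EuclideanSpace ℝ (Fin 2 × Fin 2)

/-- Lebesgue measure on the domain. -/
abbrev vol (Ω : Set Plane) : Measure Plane := volume.restrict Ω

/-- Scalar, vector and tensor fields of class `L²(Ω)`, with Mathlib's norm and inner product. -/
abbrev L2 (F : Type) [NormedAddCommGroup F] (Ω : Set Plane) := Lp F 2 (vol Ω)

/-- The classical gradient of a vector field. -/
def classicalGrad (φ : Plane → Plane) (x : Plane) : Tensor :=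
  WithLp.toLp 2 fun ik => fderiv ℝ φ x (EuclideanSpace.single ik.2 1) ik.1

/-- `φ` is a smooth vector field with compact support inside `Ω`. -/
structure IsTestField (Ω : Set Plane) (φ : Plane → Plane) : Prop where
  smooth : ContDiff ℝ ∞ φ
  compact : HasCompactSupport φ
  support_subset : tsupport φ ⊆ Ω

theorem IsTestField.add {Ω : Set Plane} {φ ψ : Plane → Plane} (hφ : IsTestField Ω φ)
    (hψ : IsTestField Ω ψ) : IsTestField Ω (φ + ψ) :=
  ⟨hφ.smooth.add hψ.smooth, hφ.compact.add hψ.compact,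
    (tsupport_add φ ψ).trans (Set.union_subset hφ.support_subset hψ.support_subset)⟩

theorem IsTestField.smul {Ω : Set Plane} {φ : Plane → Plane} (c : ℝ) (hφ : IsTestField Ω φ) :
    IsTestField Ω (c • φ) :=
  ⟨hφ.smooth.const_smul c, hφ.compact.smul_left (f := fun _ => c),
    (tsupport_smul_subset_right (fun _ => c) φ).trans hφ.support_subset⟩

theorem IsTestField.zero (Ω : Set Plane) : IsTestField Ω 0 :=
  ⟨contDiff_const, HasCompactSupport.zero, by simp [tsupport]⟩

theorem classicalGrad_zero : classicalGrad 0 = 0 := by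
  funext x
  ext ik
  simp [classicalGrad]

theorem classicalGrad_add {φ ψ : Plane → Plane} (hφ : ContDiff ℝ ∞ φ) (hψ : ContDiff ℝ ∞ ψ) :
    classicalGrad (φ + ψ) = classicalGrad φ + classicalGrad ψ := by
  funext x
  ext ik
  have h1 : DifferentiableAt ℝ φ x := (hφ.differentiable (by simp)) x
  have h2 : DifferentiableAt ℝ ψ x := (hψ.differentiable (by simp)) x
  simp [classicalGrad, fderiv_add h1 h2]

theorem classicalGrad_smul {φ : Plane → Plane} (c : ℝ) (hφ : ContDiff ℝ ∞ φ) :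
    classicalGrad (c • φ) = c • classicalGrad φ := by
  funext x
  ext ik
  have h1 : DifferentiableAt ℝ φ x := (hφ.differentiable (by simp)) x
  simp [classicalGrad, fderiv_const_smul h1 c]

/-- The pairs `(φ, ∇φ)`, as elements of `L²(Ω)² × L²(Ω)^{2×2}`, with `φ` a test field. -/
def testGraph (Ω : Set Plane) : Submodule ℝ (L2 Plane Ω × L2 Tensor Ω) where
  carrier := {g | ∃ φ, IsTestField Ω φ ∧ g.1 =ᵐ[vol Ω] φ ∧ g.2 =ᵐ[vol Ω] classicalGrad φ}
  zero_mem' := by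
    refine ⟨0, IsTestField.zero Ω, Lp.coeFn_zero .., ?_⟩
    rw [classicalGrad_zero]
    exact Lp.coeFn_zero ..
  add_mem' := by
    rintro a b ⟨φ, hφ, ha, ha'⟩ ⟨ψ, hψ, hb, hb'⟩
    refine ⟨φ + ψ, hφ.add hψ, (Lp.coeFn_add _ _).trans (ha.add hb), ?_⟩
    rw [classicalGrad_add hφ.smooth hψ.smooth]
    exact (Lp.coeFn_add _ _).trans (ha'.add hb')
  smul_mem' := by
    rintro c a ⟨φ, hφ, ha, ha'⟩
    refine ⟨c • φ, hφ.smul c, (Lp.coeFn_smul _ _).trans (ha.const_smul c), ?_⟩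
    rw [classicalGrad_smul c hφ.smooth]
    exact (Lp.coeFn_smul _ _).trans (ha'.const_smul c)

/-- The velocity space `X = H¹₀(Ω)²`: the closure of the test fields in the `H¹` norm.
An element is stored as the pair of a field `v ∈ L²(Ω)²` and its weak gradient
`∇v ∈ L²(Ω)^{2×2}` (which is determined by `v`). -/
def X (Ω : Set Plane) : Submodule ℝ (L2 Plane Ω × L2 Tensor Ω) :=
  (testGraph Ω).topologicalClosure

variable {Ω : Set Plane}

/-- The field `v` itself, as an element of `L²(Ω)²`. -/
def val (v : X Ω) : L2 Plane Ω := v.1.1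

/-- The weak gradient `∇v`. -/
def grad (v : X Ω) : L2 Tensor Ω := v.1.2

/-- The trace of a tensor. -/
def traceL : Tensor →L[ℝ] ℝ := ∑ i : Fin 2, EuclideanSpace.proj (i, i)

/-- The divergence `∇ · v`. -/
def divg (v : X Ω) : L2 ℝ Ω := traceL.compLp (grad v)

/-- The norm of `v` in `L⁴(Ω)²` (finite for every `v` in `H¹₀(Ω)²`, as `Ω` is planar). -/
def normL4 (v : X Ω) : ℝ := (eLpNorm (val v) 4 (vol Ω)).toReal

/-- The pressure space `Q = L²₀(Ω)` of square integrable functions with mean value zero. -/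
def Q (Ω : Set Plane) : Set (L2 ℝ Ω) := {q | ∫ x in Ω, q x = 0}

/-- The convective form `(u · ∇v, w)`. -/
def conv (u v w : X Ω) : ℝ :=
  ∫ x in Ω, ∑ i : Fin 2, (∑ k : Fin 2, val u x k * grad v x (i, k)) * val w x i

/-- The skew-symmetric trilinear form `b*(u, v, w)`. -/
def bstar (u v w : X Ω) : ℝ := (1 / 2) * conv u v w - (1 / 2) * conv u w v

/-- The dual norm `‖f‖₋₁ = sup_{0 ≠ v ∈ X} (f, v) / ‖∇v‖` of a bounded functional on `X`. -/
def dualNorm (f : X Ω →L[ℝ] ℝ) : ℝ :=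
  sSup {r | ∃ v : X Ω, v ≠ 0 ∧ r = f v / ‖grad v‖}

/-- The extrapolation `3 wⁿ - 3 wⁿ⁻¹ + wⁿ⁻²` (used for `n ≥ 2` only). -/
def extrap (w : ℕ → X Ω) (n : ℕ) : X Ω :=
  (3 : ℝ) • w n - (3 : ℝ) • w (n - 1) + w (n - 2)

/-- The ensemble mean `⟨u⟩ⁿ` (used for `n ≥ 2` only). -/
def mean {J : ℕ} (u : Fin J → ℕ → X Ω) (n : ℕ) : X Ω :=
  (1 / (J : ℝ)) • ∑ j, extrap (u j) n

/-- The fluctuation `u'ⱼⁿ` (used for `n ≥ 2` only). -/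
def fluct {J : ℕ} (u : Fin J → ℕ → X Ω) (j : Fin J) (n : ℕ) : X Ω :=
  extrap (u j) n - mean u n

/-- The blended difference quotient `(10 wⁿ⁺¹ - 15 wⁿ + 6 wⁿ⁻¹ - wⁿ⁻²) / (6 Δt)`
(used for `n ≥ 2` only). -/
def blendedBDF (Δt : ℝ) (w : ℕ → X Ω) (n : ℕ) : X Ω :=
  (1 / (6 * Δt)) •
    ((10 : ℝ) • w (n + 1) - (15 : ℝ) • w n + (6 : ℝ) • w (n - 1) - w (n - 2))

/-- The inverse inequality `h ‖∇v‖ ≤ C ‖v‖` on a subspace of the velocity space. -/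
def InverseInequality (Xh : Submodule ℝ (X Ω)) (h C : ℝ) : Prop :=
  ∀ v ∈ Xh, h * ‖grad v‖ ≤ C * ‖val v‖

/-- `(u, p)` solves the fully discrete ensemble method in `Xh × Qh`, with viscosity `ν`,
time step `Δt` and forces `fⱼⁿ`, for the time levels up to `N`: all velocities
(the starting values at the levels `0, 1, 2` included) are in `Xh`,
and for `2 ≤ n < N` the discrete equations for the level `n + 1` hold. -/
structure IsDiscreteSolution (Xh : Submodule ℝ (X Ω)) (Qh : Submodule ℝ (L2 ℝ Ω))
    (ν Δt : ℝ) {J : ℕ} (f : Fin J → ℕ → X Ω →L[ℝ] ℝ) (N : ℕ)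
    (u : Fin J → ℕ → X Ω) (p : Fin J → ℕ → L2 ℝ Ω) : Prop where
  velocity_mem : ∀ j, ∀ n ≤ N, u j n ∈ Xh
  pressure_mem : ∀ j n, 2 ≤ n → n < N → p j (n + 1) ∈ Qh
  momentum : ∀ j n, 2 ≤ n → n < N → ∀ v ∈ Xh,
    inner ℝ (val (blendedBDF Δt (u j) n)) (val v)
      + bstar (mean u n) (u j (n + 1)) v
      + bstar (fluct u j n) (extrap (u j) n) v
      - inner ℝ (p j (n + 1)) (divg v)
      + ν * inner ℝ (grad (u j (n + 1))) (grad v) = f j (n + 1) v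
  incompressible : ∀ j n, 2 ≤ n → n < N → ∀ q ∈ Qh, inner ℝ (divg (u j (n + 1))) q = 0

/-- The energy `(‖wⁿ‖² + ‖3wⁿ - wⁿ⁻¹‖² + ‖3wⁿ - 3wⁿ⁻¹ + wⁿ⁻²‖²) / 12`
(used for `n ≥ 2` only). -/
def energy (w : ℕ → X Ω) (n : ℕ) : ℝ :=
  (1 / 12) * ‖val (w n)‖ ^ 2 + (1 / 12) * ‖val ((3 : ℝ) • w n - w (n - 1))‖ ^ 2
    + (1 / 12) * ‖val (extrap w n)‖ ^ 2

end EnsembleNS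

end

open EnsembleNS

/-!
Testing the scheme with `u_j^{n+1}` turns the blended difference quotient into an energy difference
plus `‖D‖² / (12 Δt)`, where `D = u^{n+1} - 3 u^n + 3 u^{n-1} - u^{n-2}`. The pressure drops out by
discrete incompressibility and the mean flow by skew-symmetry, which also leaves only
`b*(u', D, u^{n+1})` of the explicit fluctuation term. Integration by parts moves the derivative
off `D`, `b*(u', D, w) = -(u' · ∇w, D) - ½ (∇ · u', D · w)`, so only `‖D‖_{L⁴}` has to be
controlled. The Ladyzhenskaya inequality `‖D‖²_{L⁴} ≤ 2 S ‖D‖ ‖∇D‖` and the inverse inequality bound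
`h ‖D‖²_{L⁴}` by a multiple of `‖D‖²`, and under the time-step condition Young's inequality absorbs
the fluctuation term into the numerical and viscous dissipation. Summation over `n` telescopes.
-/

namespace EnsembleNS

open Filter Topology
open scoped NNReal ENNReal InnerProductSpace

section Sobolev

variable {E F : Type*} [NormedAddCommGroup E] [NormedSpace ℝ E] [FiniteDimensional ℝ E]
  [MeasurableSpace E] [BorelSpace E] (μ : Measure E) [μ.IsAddHaarMeasure] [NormedAddCommGroup F]
  {u : E → F} {q : ℝ≥0}

theorem eLpNorm_le_measure_rpow_mul_eLpNorm_fderiv [NormedSpace ℝ F] (hu : ContDiff ℝ 1 u)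
    (hc : HasCompactSupport u) {s : Set E} (hs : tsupport u ⊆ s)
    (hq : NNReal.HolderConjugate (Module.finrank ℝ E) q) {p : ℝ≥0∞} (hp : 1 ≤ p) :
    eLpNorm u q μ ≤ eLpNormLESNormFDerivOneConst μ q *
      (μ s ^ (1 - 1 / p.toReal) * eLpNorm (fderiv ℝ u) p μ) := by
  have hsupp : Function.support (fderiv ℝ u) ⊆ s := (support_fderiv_subset ℝ).trans hs
  refine (eLpNorm_le_eLpNorm_fderiv_one μ hu hc hq).trans ?_
  gcongr
  have hmeas := (hu.continuous_fderiv one_ne_zero).aestronglyMeasurable (μ := μ.restrict s)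
  calc eLpNorm (fderiv ℝ u) 1 μ = eLpNorm (fderiv ℝ u) 1 (μ.restrict s) :=
        (eLpNorm_restrict_eq_of_support_subset (f := fderiv ℝ u) hsupp).symm
    _ ≤ eLpNorm (fderiv ℝ u) p (μ.restrict s) * μ s ^ (1 - 1 / p.toReal) := by
        simpa using eLpNorm_le_eLpNorm_mul_rpow_measure_univ hp hmeas
    _ = μ s ^ (1 - 1 / p.toReal) * eLpNorm (fderiv ℝ u) p μ := by
        rw [eLpNorm_restrict_eq_of_support_subset (f := fderiv ℝ u) hsupp, mul_comm]

/-- The Gagliardo–Nirenberg inequality for `‖u‖²`, whose derivative is at most `2 ‖u‖ ‖Du‖`. -/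
theorem eLpNorm_two_mul_sq_le_mul_eLpNorm_fderiv [InnerProductSpace ℝ F] (hu : ContDiff ℝ 1 u)
    (hc : HasCompactSupport u) (hq : NNReal.HolderConjugate (Module.finrank ℝ E) q)
    {p r : ℝ≥0∞} [ENNReal.HolderTriple p r 1] :
    eLpNorm u (q * 2) μ ^ 2 ≤ 2 * eLpNormLESNormFDerivOneConst μ q *
      (eLpNorm u p μ * eLpNorm (fderiv ℝ u) r μ) := by
  have hsq : eLpNorm (fun x => ‖u x‖ ^ 2) q μ = eLpNorm u (q * 2) μ ^ 2 := by
    simpa using eLpNorm_norm_rpow (p := q) (μ := μ) u two_pos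
  have hfderiv : ∀ x, ‖fderiv ℝ (fun x => ‖u x‖ ^ 2) x‖ ≤
      ‖(2 : ℝ) * (‖u x‖ * ‖fderiv ℝ u x‖)‖ := by
    intro x
    rw [((hu.differentiable one_ne_zero x).hasFDerivAt.norm_sq).fderiv,
      Real.norm_of_nonneg (by positivity), two_nsmul, ← two_smul ℝ, norm_smul,
      Real.norm_of_nonneg zero_le_two, ← innerSL_apply_norm ℝ (u x)]
    gcongr
    exact ContinuousLinearMap.opNorm_comp_le _ _
  calc eLpNorm u (q * 2) μ ^ 2
      ≤ eLpNormLESNormFDerivOneConst μ q * eLpNorm (fderiv ℝ fun x => ‖u x‖ ^ 2) 1 μ := by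
        rw [← hsq]
        exact eLpNorm_le_eLpNorm_fderiv_one μ (hu.norm_sq ℝ)
          (hc.comp_left (g := fun y => ‖y‖ ^ 2) (by simp)) hq
    _ ≤ eLpNormLESNormFDerivOneConst μ q * (2 * eLpNorm u p μ * eLpNorm (fderiv ℝ u) r μ) := by
        gcongr
        exact (eLpNorm_mono hfderiv).trans <| eLpNorm_le_eLpNorm_mul_eLpNorm_of_nnnorm
          hu.continuous.aestronglyMeasurable
          (hu.continuous_fderiv one_ne_zero).aestronglyMeasurable
          (fun a b => (2 : ℝ) * (‖a‖ * ‖b‖)) 2 (.of_forall fun x => by simp [mul_assoc])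
    _ = _ := by ring

theorem integral_fderiv_apply_eq_zero [NormedSpace ℝ F] (hu : ContDiff ℝ 1 u)
    (hc : HasCompactSupport u) (v : E) : ∫ x, fderiv ℝ u x v ∂μ = 0 := by
  have hint : Integrable (fun x => fderiv ℝ u x v) μ :=
    Continuous.integrable_of_hasCompactSupport (by fun_prop (disch := simp))
      (hc.fderiv_apply (𝕜 := ℝ) v)
  simpa using integral_bilinear_hasFDerivAt_right_eq_neg_left_of_integrable
    (B := ContinuousLinearMap.lsmul ℝ ℝ) (f := fun _ : E => (1 : ℝ)) (f' := 0) (v := v)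
    (by simp) (by simpa using hint)
    (by simpa using hu.continuous.integrable_of_hasCompactSupport hc)
    (fun x _ => hasFDerivAt_const 1 x)
    (fun x _ => (hu.differentiable one_ne_zero x).hasFDerivAt)

end Sobolev

theorem lowerSemicontinuous_eLpNorm {α E : Type*} [MeasurableSpace α] {μ : Measure α}
    [NormedAddCommGroup E] (p q : ℝ≥0∞) [Fact (1 ≤ p)] :
    LowerSemicontinuous fun f : Lp E p μ => eLpNorm f q μ := by
  refine lowerSemicontinuous_iff_isClosed_preimage.2 fun b => IsSeqClosed.isClosed ?_
  intro f g hf hlim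
  obtain ⟨ns, -, hae⟩ := (tendstoInMeasure_of_tendsto_Lp hlim).exists_seq_tendsto_ae
  calc eLpNorm g q μ
      ≤ liminf (fun n => eLpNorm (f (ns n)) q μ) atTop :=
        Lp.eLpNorm_lim_le_liminf_eLpNorm (fun n => Lp.aestronglyMeasurable (f (ns n))) g hae
    _ ≤ liminf (fun _ => b) atTop := liminf_le_liminf (.of_forall fun n => hf (ns n))
    _ = b := liminf_const b

section Dyad

variable {ι κ : Type*} [Fintype ι] [Fintype κ]

theorem norm_toLp_mul (a : EuclideanSpace ℝ ι) (b : EuclideanSpace ℝ κ) :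
    ‖WithLp.toLp 2 fun ik : ι × κ => a ik.1 * b ik.2‖ = ‖a‖ * ‖b‖ := by
  simp [EuclideanSpace.norm_eq, Fintype.sum_prod_type, mul_pow, ← Finset.mul_sum,
    ← Finset.sum_mul, Real.sqrt_mul (Finset.sum_nonneg fun i _ => sq_nonneg (a i))]

/-- The tensor product `a ⊗ b` of two vectors, with entries `aᵢ bₖ`, as a bounded bilinear map. -/
noncomputable def dyad :
    EuclideanSpace ℝ ι →L[ℝ] EuclideanSpace ℝ κ →L[ℝ] EuclideanSpace ℝ (ι × κ) :=
  LinearMap.mkContinuous₂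
    (LinearMap.mk₂ ℝ (fun a b => WithLp.toLp 2 fun ik => a ik.1 * b ik.2)
      (fun _ _ _ => by ext; simp [add_mul]) (fun _ _ _ => by ext; simp [mul_assoc])
      (fun _ _ _ => by ext; simp [mul_add]) (fun _ _ _ => by ext; simp [mul_left_comm])) 1
    fun a b => by simpa using (norm_toLp_mul a b).le

theorem norm_dyad (a : EuclideanSpace ℝ ι) (b : EuclideanSpace ℝ κ) :
    ‖dyad a b‖ = ‖a‖ * ‖b‖ :=
  norm_toLp_mul a b

theorem opNorm_dyad_le : ‖(dyad : EuclideanSpace ℝ ι →L[ℝ] EuclideanSpace ℝ κ →L[ℝ] _)‖ ≤ 1 :=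
  LinearMap.mkContinuous₂_norm_le _ zero_le_one _

theorem inner_dyad (a : EuclideanSpace ℝ ι) (b : EuclideanSpace ℝ κ)
    (G : EuclideanSpace ℝ (ι × κ)) :
    ⟪dyad a b, G⟫_ℝ = ∑ i, (∑ k, b k * G (i, k)) * a i := by
  simp only [dyad, LinearMap.mkContinuous₂_apply, LinearMap.mk₂_apply, PiLp.inner_apply,
    Fintype.sum_prod_type, Finset.sum_mul, Real.inner_apply]
  exact Finset.sum_congr rfl fun i _ => Finset.sum_congr rfl fun k _ => by ring

end Dyad

section ClassicalGradient

theorem inner_dyad_classicalGrad (φ : Plane → Plane) (x a b : Plane) :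
    ⟪dyad b a, classicalGrad φ x⟫_ℝ = ⟪b, fderiv ℝ φ x a⟫_ℝ := by
  conv_rhs => rw [← (EuclideanSpace.basisFun (Fin 2) ℝ).sum_repr a]
  rw [inner_dyad]
  simp [classicalGrad, PiLp.inner_apply, mul_comm]

theorem norm_fderiv_le_norm_classicalGrad (φ : Plane → Plane) (x : Plane) :
    ‖fderiv ℝ φ x‖ ≤ ‖classicalGrad φ x‖ := by
  refine ContinuousLinearMap.opNorm_le_of_re_inner_le (norm_nonneg _) fun a b ha hb => ?_
  calc ⟪fderiv ℝ φ x a, b⟫_ℝ = ⟪dyad b a, classicalGrad φ x⟫_ℝ := by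
        rw [inner_dyad_classicalGrad, real_inner_comm]
    _ ≤ ‖dyad b a‖ * ‖classicalGrad φ x‖ := real_inner_le_norm _ _
    _ = ‖classicalGrad φ x‖ := by rw [norm_dyad, ha, hb, one_mul, one_mul]

theorem support_classicalGrad_subset (φ : Plane → Plane) :
    Function.support (classicalGrad φ) ⊆ tsupport φ := by
  refine fun x hx => support_fderiv_subset ℝ fun h => hx ?_
  ext
  simp [classicalGrad, h]

theorem traceL_classicalGrad (φ : Plane → Plane) (x : Plane) :
    traceL (classicalGrad φ x) = ∑ i, fderiv ℝ φ x (EuclideanSpace.single i 1) i := by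
  simp [traceL, classicalGrad]

theorem integral_traceL_classicalGrad_eq_zero {φ : Plane → Plane} (hφ : ContDiff ℝ 1 φ)
    (hc : HasCompactSupport φ) : ∫ x, traceL (classicalGrad φ x) = 0 := by
  have hint : ∀ i : Fin 2, Integrable fun x => fderiv ℝ φ x (EuclideanSpace.single i 1) := fun i =>
    Continuous.integrable_of_hasCompactSupport (by fun_prop (disch := simp))
      (hc.fderiv_apply (𝕜 := ℝ) _)
  simp only [traceL_classicalGrad]
  refine (integral_finsetSum _ fun i _ =>
    (EuclideanSpace.proj (𝕜 := ℝ) i).integrable_comp (hint i)).trans ?_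
  refine Finset.sum_eq_zero fun i _ => ?_
  refine ((EuclideanSpace.proj (𝕜 := ℝ) i).integral_comp_comm (hint i)).trans ?_
  rw [integral_fderiv_apply_eq_zero _ hφ hc, map_zero]

theorem traceL_classicalGrad_smul {s : Plane → ℝ} {φ : Plane → Plane} {x : Plane}
    (hs : DifferentiableAt ℝ s x) (hφ : DifferentiableAt ℝ φ x) :
    traceL (classicalGrad (fun y => s y • φ y) x) =
      s x * traceL (classicalGrad φ x) + fderiv ℝ s x (φ x) := by
  have hφx : fderiv ℝ s x (φ x) = ∑ i, φ x i * fderiv ℝ s x (EuclideanSpace.single i 1) := by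
    conv_lhs => rw [← (EuclideanSpace.basisFun (Fin 2) ℝ).sum_repr (φ x)]
    simp
  simp only [traceL_classicalGrad, fderiv_fun_smul hs hφ, hφx, Fin.sum_univ_two, add_apply,
    smul_apply, ContinuousLinearMap.smulRight_apply, PiLp.add_apply, PiLp.smul_apply, smul_eq_mul]
  ring

namespace IsTestField

variable {Ω : Set Plane} {φ ψ χ : Plane → Plane}

theorem contDiff_one (hφ : IsTestField Ω φ) : ContDiff ℝ 1 φ :=
  hφ.smooth.of_le (by simp)

theorem eq_zero_of_notMem (hφ : IsTestField Ω φ) {x : Plane} (hx : x ∉ Ω) : φ x = 0 :=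
  image_eq_zero_of_notMem_tsupport fun h => hx (hφ.support_subset h)

theorem classicalGrad_eq_zero_of_notMem (hφ : IsTestField Ω φ) {x : Plane} (hx : x ∉ Ω) :
    classicalGrad φ x = 0 :=
  Function.notMem_support.1 fun h => hx (hφ.support_subset (support_classicalGrad_subset φ h))

/-- The divergence theorem for the field `(ψ · χ) φ`. -/
theorem setIntegral_convection_add_eq_zero (hφ : IsTestField Ω φ) (hψ : IsTestField Ω ψ)
    (hχ : IsTestField Ω χ) :
    ∫ x in Ω, (⟪dyad (χ x) (φ x), classicalGrad ψ x⟫_ℝ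
        + ⟪dyad (ψ x) (φ x), classicalGrad χ x⟫_ℝ
        + traceL (classicalGrad φ x) * ⟪ψ x, χ x⟫_ℝ) = 0 := by
  have hdiff : ∀ {θ}, IsTestField Ω θ → Differentiable ℝ θ := fun hθ =>
    hθ.contDiff_one.differentiable one_ne_zero
  have htrace : ∀ x, traceL (classicalGrad (fun y => ⟪ψ y, χ y⟫_ℝ • φ y) x)
      = ⟪dyad (χ x) (φ x), classicalGrad ψ x⟫_ℝ + ⟪dyad (ψ x) (φ x), classicalGrad χ x⟫_ℝ
        + traceL (classicalGrad φ x) * ⟪ψ x, χ x⟫_ℝ := by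
    intro x
    rw [traceL_classicalGrad_smul ((hdiff hψ x).inner ℝ (hdiff hχ x)) (hdiff hφ x),
      fderiv_inner_apply ℝ (hdiff hψ x) (hdiff hχ x), inner_dyad_classicalGrad,
      inner_dyad_classicalGrad, real_inner_comm (fderiv ℝ ψ x (φ x))]
    ring
  rw [setIntegral_eq_integral_of_forall_compl_eq_zero]
  · simp only [← htrace]
    exact integral_traceL_classicalGrad_eq_zero
      ((hψ.contDiff_one.inner ℝ hχ.contDiff_one).smul hφ.contDiff_one)
      (hφ.compact.smul_left (f := fun y => ⟪ψ y, χ y⟫_ℝ))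
  · intro x hx
    simp [hφ.eq_zero_of_notMem hx, hφ.classicalGrad_eq_zero_of_notMem hx]

end IsTestField

end ClassicalGradient

section VelocitySpace

/-- The constant of the Gagliardo–Nirenberg–Sobolev inequality `‖u‖_{L²} ≤ S ‖∇u‖_{L¹}` in the
plane. -/
noncomputable def sobolevConst : ℝ≥0 :=
  eLpNormLESNormFDerivOneConst (volume : Measure Plane) 2

theorem holderConjugate_finrank_plane_two :
    NNReal.HolderConjugate (Module.finrank ℝ Plane) 2 := by
  simpa using NNReal.HolderConjugate.two_two

variable {Ω : Set Plane}

theorem IsTestField.eLpNorm_restrict {φ : Plane → Plane} (hφ : IsTestField Ω φ) (p : ℝ≥0∞) :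
    eLpNorm φ p (vol Ω) = eLpNorm φ p volume :=
  eLpNorm_restrict_eq_of_support_subset fun x hx => by
    by_contra h
    exact hx (hφ.eq_zero_of_notMem h)

theorem IsTestField.eLpNorm_fderiv_le {φ : Plane → Plane} (hφ : IsTestField Ω φ) (p : ℝ≥0∞) :
    eLpNorm (fderiv ℝ φ) p volume ≤ eLpNorm (classicalGrad φ) p (vol Ω) := by
  have hsupp : Function.support (classicalGrad φ) ⊆ Ω :=
    (support_classicalGrad_subset φ).trans hφ.support_subset
  exact (eLpNorm_mono (norm_fderiv_le_norm_classicalGrad φ)).trans_eq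
    (eLpNorm_restrict_eq_of_support_subset (f := classicalGrad φ) hsupp).symm

theorem IsTestField.eLpNorm_two_le {φ : Plane → Plane} (hφ : IsTestField Ω φ) :
    eLpNorm φ 2 (vol Ω) ≤
      sobolevConst * (volume Ω ^ (1 / 2 : ℝ) * eLpNorm (classicalGrad φ) 2 (vol Ω)) := by
  rw [hφ.eLpNorm_restrict, show (1 / 2 : ℝ) = 1 - 1 / (2 : ℝ≥0∞).toReal by norm_num]
  refine (eLpNorm_le_measure_rpow_mul_eLpNorm_fderiv volume hφ.contDiff_one hφ.compact
    hφ.support_subset holderConjugate_finrank_plane_two one_le_two).trans ?_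
  gcongr
  · rfl
  · exact hφ.eLpNorm_fderiv_le 2

theorem IsTestField.eLpNorm_four_sq_le {φ : Plane → Plane} (hφ : IsTestField Ω φ) :
    eLpNorm φ 4 (vol Ω) ^ 2 ≤ 2 * sobolevConst *
      (eLpNorm φ 2 (vol Ω) * eLpNorm (classicalGrad φ) 2 (vol Ω)) := by
  rw [hφ.eLpNorm_restrict, hφ.eLpNorm_restrict]
  calc eLpNorm φ 4 volume ^ 2
      = eLpNorm φ ((2 : ℝ≥0) * 2) volume ^ 2 := by norm_num
    _ ≤ 2 * sobolevConst * (eLpNorm φ 2 volume * eLpNorm (fderiv ℝ φ) 2 volume) :=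
        eLpNorm_two_mul_sq_le_mul_eLpNorm_fderiv volume hφ.contDiff_one hφ.compact
          holderConjugate_finrank_plane_two
    _ ≤ _ := by
        gcongr
        exact hφ.eLpNorm_fderiv_le 2

/-- The velocity given by a test field. -/
noncomputable def ofTestGraph : testGraph Ω → X Ω :=
  Set.inclusion (testGraph Ω).le_topologicalClosure

theorem denseRange_ofTestGraph : DenseRange (ofTestGraph (Ω := Ω)) :=
  (denseRange_inclusion_iff (testGraph Ω).le_topologicalClosure).2
    (testGraph Ω).topologicalClosure_coe.le

theorem exists_isTestField (g : testGraph Ω) : ∃ φ, IsTestField Ω φ ∧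
    val (ofTestGraph g) =ᵐ[vol Ω] φ ∧ grad (ofTestGraph g) =ᵐ[vol Ω] classicalGrad φ :=
  g.2

@[fun_prop]
theorem continuous_val : Continuous (val (Ω := Ω)) :=
  continuous_fst.comp continuous_subtype_val

@[fun_prop]
theorem continuous_grad : Continuous (grad (Ω := Ω)) :=
  continuous_snd.comp continuous_subtype_val

theorem norm_val_le (hΩ : volume Ω ≠ ⊤) (v : X Ω) :
    ‖val v‖ ≤ sobolevConst * √(volume.real Ω) * ‖grad v‖ := by
  refine denseRange_ofTestGraph.induction_on v
    (isClosed_le (by fun_prop) (by fun_prop)) fun g => ?_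
  obtain ⟨φ, hφ, hval, hgrad⟩ := exists_isTestField g
  have hle := hφ.eLpNorm_two_le
  rw [← eLpNorm_congr_ae hval, ← eLpNorm_congr_ae hgrad] at hle
  have hfin := ENNReal.mul_ne_top (ENNReal.coe_ne_top (r := sobolevConst)) <|
    ENNReal.mul_ne_top (ENNReal.rpow_ne_top_of_nonneg one_half_pos.le hΩ)
      (Lp.eLpNorm_ne_top (grad (ofTestGraph g)))
  simpa [Lp.norm_def, Real.sqrt_eq_rpow, Measure.real, ENNReal.toReal_rpow, mul_assoc]
    using ENNReal.toReal_mono hfin hle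

theorem eLpNorm_val_four_sq_le (v : X Ω) : eLpNorm (val v) 4 (vol Ω) ^ 2 ≤
    ENNReal.ofReal (2 * sobolevConst * (‖val v‖ * ‖grad v‖)) := by
  refine denseRange_ofTestGraph.induction_on v ?_ fun g => ?_
  · have hlsc : LowerSemicontinuous fun v : L2 Plane Ω => eLpNorm v 4 (vol Ω) ^ 2 :=
      (ENNReal.continuous_pow 2).comp_lowerSemicontinuous (lowerSemicontinuous_eLpNorm 2 4)
        (pow_left_mono 2)
    exact hlsc.isClosed_epigraph.preimage (f := fun v : X Ω =>
      (val v, ENNReal.ofReal (2 * sobolevConst * (‖val v‖ * ‖grad v‖))))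
      (continuous_val.prodMk (ENNReal.continuous_ofReal.comp (by fun_prop)))
  · obtain ⟨φ, hφ, hval, hgrad⟩ := exists_isTestField g
    rw [eLpNorm_congr_ae hval]
    refine hφ.eLpNorm_four_sq_le.trans_eq ?_
    rw [← eLpNorm_congr_ae hval, ← eLpNorm_congr_ae hgrad, ← Lp.enorm_def, ← Lp.enorm_def,
      ENNReal.ofReal_mul (by positivity), ENNReal.ofReal_mul (by positivity),
      ENNReal.ofReal_mul (by positivity)]
    simp

instance : Fact ((1 : ℝ≥0∞) ≤ 4) := ⟨by norm_num⟩

instance : ENNReal.HolderTriple 4 4 2 where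
  inv_add_inv_eq_inv := by
    rw [show (4 : ℝ≥0∞) = 2 * 2 by norm_num, ENNReal.mul_inv (by simp) (by simp), ← mul_add,
      ENNReal.inv_two_add_inv_two, mul_one]

theorem memLp_val_four (v : X Ω) : MemLp (val v) 4 (vol Ω) :=
  ⟨Lp.aestronglyMeasurable _, (ENNReal.pow_lt_top_iff.1
    ((eLpNorm_val_four_sq_le v).trans_lt ENNReal.ofReal_lt_top)).resolve_right two_ne_zero⟩

theorem normL4_sq_le (v : X Ω) : normL4 v ^ 2 ≤ 2 * sobolevConst * (‖val v‖ * ‖grad v‖) := by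
  rw [normL4, ← ENNReal.toReal_pow]
  exact ENNReal.toReal_le_of_le_ofReal (by positivity) (eLpNorm_val_four_sq_le v)

/-- The constant of the embedding `‖v‖_{L⁴} ≤ L ‖∇v‖` of `H¹₀(Ω)²` into `L⁴(Ω)²`. -/
noncomputable def embeddingConst (Ω : Set Plane) : ℝ :=
  sobolevConst * √(2 * √(volume.real Ω))

theorem embeddingConst_nonneg (Ω : Set Plane) : 0 ≤ embeddingConst Ω := by
  unfold embeddingConst
  positivity

theorem normL4_le_mul_norm_grad (hΩ : volume Ω ≠ ⊤) (v : X Ω) :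
    normL4 v ≤ embeddingConst Ω * ‖grad v‖ := by
  refine le_of_sq_le_sq ?_ (mul_nonneg (embeddingConst_nonneg Ω) (norm_nonneg _))
  calc normL4 v ^ 2 ≤ 2 * sobolevConst * (‖val v‖ * ‖grad v‖) := normL4_sq_le v
    _ ≤ 2 * sobolevConst * ((sobolevConst * √(volume.real Ω) * ‖grad v‖) * ‖grad v‖) := by
        gcongr
        exact norm_val_le hΩ v
    _ = (embeddingConst Ω * ‖grad v‖) ^ 2 := by
        rw [embeddingConst, mul_pow, mul_pow, Real.sq_sqrt (by positivity)]
        ring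

/-- The embedding of `H¹₀(Ω)²` into `L⁴(Ω)²`. -/
noncomputable def toL4 : X Ω →L[ℝ] Lp Plane 4 (vol Ω) :=
  LinearMap.mkContinuous
    { toFun v := (memLp_val_four v).toLp
      map_add' v w := by
        rw [← MemLp.toLp_add]
        exact MemLp.toLp_congr _ _ (Lp.coeFn_add _ _)
      map_smul' c v := by
        rw [RingHom.id_apply, ← MemLp.toLp_const_smul]
        exact MemLp.toLp_congr _ _ (Lp.coeFn_smul _ _) } √(2 * sobolevConst) fun v => by
    have hval : ‖val v‖ ≤ ‖v‖ := norm_fst_le v.1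
    have hgrad : ‖grad v‖ ≤ ‖v‖ := norm_snd_le v.1
    refine le_of_sq_le_sq ?_ (by positivity)
    calc ‖(memLp_val_four v).toLp‖ ^ 2 = normL4 v ^ 2 := by rw [Lp.norm_toLp, normL4]
      _ ≤ 2 * sobolevConst * (‖val v‖ * ‖grad v‖) := normL4_sq_le v
      _ ≤ 2 * sobolevConst * (‖v‖ * ‖v‖) := by gcongr
      _ = (√(2 * sobolevConst) * ‖v‖) ^ 2 := by
        rw [mul_pow, Real.sq_sqrt (by positivity), sq]

theorem coeFn_toL4 (v : X Ω) : toL4 v =ᵐ[vol Ω] val v :=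
  (memLp_val_four v).coeFn_toLp

theorem norm_toL4 (v : X Ω) : ‖toL4 v‖ = normL4 v :=
  Lp.norm_toLp _ (memLp_val_four v)

theorem normL4_nonneg (v : X Ω) : 0 ≤ normL4 v := ENNReal.toReal_nonneg

end VelocitySpace

section TrilinearForm

theorem inner_add_inner_add_inner_eq_integral {α E F G : Type*} [MeasurableSpace α]
    {μ : Measure α} [NormedAddCommGroup E] [InnerProductSpace ℝ E] [NormedAddCommGroup F]
    [InnerProductSpace ℝ F] [NormedAddCommGroup G] [InnerProductSpace ℝ G]
    (e e' : Lp E 2 μ) (f f' : Lp F 2 μ) (g g' : Lp G 2 μ) :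
    ⟪e, e'⟫_ℝ + ⟪f, f'⟫_ℝ + ⟪g, g'⟫_ℝ =
      ∫ x, (⟪e x, e' x⟫_ℝ + ⟪f x, f' x⟫_ℝ + ⟪g x, g' x⟫_ℝ) ∂μ := by
  rw [L2.inner_def, L2.inner_def, L2.inner_def, integral_add _ (L2.integrable_inner g g'),
    integral_add (L2.integrable_inner e e') (L2.integrable_inner f f')]
  exact (L2.integrable_inner e e').add (L2.integrable_inner f f')

variable {Ω : Set Plane}

/-- The field of tensors `v ⊗ w` formed from two `L⁴` vector fields. -/
noncomputable def dyadL2 : Lp Plane 4 (vol Ω) →L[ℝ] Lp Plane 4 (vol Ω) →L[ℝ] L2 Tensor Ω :=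
  dyad.holderL (vol Ω) 4 4 2

/-- The scalar field `v · w` formed from two `L⁴` vector fields. -/
noncomputable def dotL2 : Lp Plane 4 (vol Ω) →L[ℝ] Lp Plane 4 (vol Ω) →L[ℝ] L2 ℝ Ω :=
  (innerSL ℝ : Plane →L[ℝ] Plane →L[ℝ] ℝ).holderL (vol Ω) 4 4 2

theorem coeFn_dyadL2 (v w : Lp Plane 4 (vol Ω)) :
    dyadL2 v w =ᵐ[vol Ω] fun x => dyad (v x) (w x) :=
  ContinuousLinearMap.coeFn_holder (r := 2) (dyad : Plane →L[ℝ] Plane →L[ℝ] Tensor) v w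

theorem coeFn_dotL2 (v w : Lp Plane 4 (vol Ω)) :
    dotL2 v w =ᵐ[vol Ω] fun x => ⟪v x, w x⟫_ℝ :=
  ContinuousLinearMap.coeFn_holder (r := 2) (innerSL ℝ : Plane →L[ℝ] Plane →L[ℝ] ℝ) v w

theorem norm_dyadL2_le (v w : Lp Plane 4 (vol Ω)) : ‖dyadL2 v w‖ ≤ ‖v‖ * ‖w‖ := by
  refine (ContinuousLinearMap.norm_holder_apply_apply_le (r := 2)
    (dyad : Plane →L[ℝ] Plane →L[ℝ] Tensor) v w).trans ?_
  rw [mul_assoc]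
  exact mul_le_of_le_one_left (by positivity) opNorm_dyad_le

theorem norm_dotL2_le (v w : Lp Plane 4 (vol Ω)) : ‖dotL2 v w‖ ≤ ‖v‖ * ‖w‖ := by
  refine (ContinuousLinearMap.norm_holder_apply_apply_le (r := 2)
    (innerSL ℝ : Plane →L[ℝ] Plane →L[ℝ] ℝ) v w).trans ?_
  rw [mul_assoc]
  exact mul_le_of_le_one_left (by positivity) (norm_innerSL_le ℝ)

theorem coeFn_divg (u : X Ω) : divg u =ᵐ[vol Ω] fun x => traceL (grad u x) :=
  traceL.coeFn_compLp (grad u)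

@[fun_prop]
theorem continuous_divg : Continuous (divg (Ω := Ω)) :=
  (traceL.compLpL 2 (vol Ω)).continuous.comp continuous_grad

theorem conv_eq_inner (u v w : X Ω) : conv u v w = ⟪dyadL2 (toL4 w) (toL4 u), grad v⟫_ℝ := by
  rw [L2.inner_def]
  refine integral_congr_ae ?_
  filter_upwards [coeFn_dyadL2 (toL4 w) (toL4 u), coeFn_toL4 w, coeFn_toL4 u] with x h hw hu
  rw [h, hw, hu, inner_dyad]

theorem conv_sub_middle (u v v' w : X Ω) : conv u (v - v') w = conv u v w - conv u v' w := by
  simp only [conv_eq_inner, ← inner_sub_right]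
  rfl

theorem conv_sub_right (u v w w' : X Ω) : conv u v (w - w') = conv u v w - conv u v w' := by
  simp only [conv_eq_inner, map_sub, sub_apply, inner_sub_left]

theorem abs_conv_le (u v w : X Ω) : |conv u v w| ≤ normL4 u * ‖grad v‖ * normL4 w := by
  rw [conv_eq_inner, ← norm_toL4, ← norm_toL4]
  calc _ ≤ ‖dyadL2 (toL4 w) (toL4 u)‖ * ‖grad v‖ := abs_real_inner_le_norm _ _
    _ ≤ ‖toL4 w‖ * ‖toL4 u‖ * ‖grad v‖ := by
        gcongr
        exact norm_dyadL2_le _ _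
    _ = _ := by ring

theorem conv_add_conv_swap_add_inner_eq_setIntegral (u v w : X Ω) :
    conv u v w + conv u w v + ⟪divg u, dotL2 (toL4 v) (toL4 w)⟫_ℝ =
      ∫ x in Ω, (⟪dyad (val w x) (val u x), grad v x⟫_ℝ +
        ⟪dyad (val v x) (val u x), grad w x⟫_ℝ + traceL (grad u x) * ⟪val v x, val w x⟫_ℝ) := by
  rw [conv_eq_inner, conv_eq_inner]
  refine (inner_add_inner_add_inner_eq_integral (dyadL2 (toL4 w) (toL4 u)) (grad v)
    (dyadL2 (toL4 v) (toL4 u)) (grad w) (divg u) (dotL2 (toL4 v) (toL4 w))).trans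
    (integral_congr_ae ?_)
  filter_upwards [coeFn_dyadL2 (toL4 w) (toL4 u), coeFn_dyadL2 (toL4 v) (toL4 u), coeFn_divg u,
    coeFn_dotL2 (toL4 v) (toL4 w), coeFn_toL4 u, coeFn_toL4 v, coeFn_toL4 w]
    with x hwu hvu hdiv hvw hu hv hw
  rw [hwu, hvu, hdiv, hvw, hu, hv, hw, Real.inner_apply, mul_comm (traceL _)]

/-- The left side is continuous in `H¹₀(Ω)²`, so it suffices to integrate the divergence of
`(v · w) u` for test fields. -/
theorem conv_add_conv_swap_add_inner_divg (u v w : X Ω) :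
    conv u v w + conv u w v + ⟪divg u, dotL2 (toL4 v) (toL4 w)⟫_ℝ = 0 := by
  refine denseRange_ofTestGraph.induction_on₃
    (p := fun u v w => conv u v w + conv u w v + ⟪divg u, dotL2 (toL4 v) (toL4 w)⟫_ℝ = 0)
    ?_ (fun g₁ g₂ g₃ => ?_) u v w
  · simp only [conv_eq_inner]
    exact isClosed_eq (by fun_prop) (by fun_prop)
  · obtain ⟨φ, hφ, hu, hu'⟩ := exists_isTestField g₁
    obtain ⟨ψ, hψ, hv, hv'⟩ := exists_isTestField g₂
    obtain ⟨χ, hχ, hw, hw'⟩ := exists_isTestField g₃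
    refine (conv_add_conv_swap_add_inner_eq_setIntegral _ _ _).trans
      ((integral_congr_ae ?_).trans (hφ.setIntegral_convection_add_eq_zero hψ hχ))
    filter_upwards [hu, hu', hv, hv', hw, hw'] with x hu hu' hv hv' hw hw'
    rw [hu, hu', hv, hv', hw, hw']

end TrilinearForm

section SkewForm

variable {Ω : Set Plane}

theorem bstar_self (u v : X Ω) : bstar u v v = 0 := sub_self _

theorem bstar_sub_middle (u v v' w : X Ω) : bstar u (v - v') w = bstar u v w - bstar u v' w := by
  simp only [bstar, conv_sub_middle, conv_sub_right]
  ring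

theorem bstar_eq (u v w : X Ω) :
    bstar u v w = -conv u w v - 1 / 2 * ⟪divg u, dotL2 (toL4 v) (toL4 w)⟫_ℝ := by
  rw [bstar]
  linarith [conv_add_conv_swap_add_inner_divg u v w]

theorem abs_bstar_le (hΩ : volume Ω ≠ ⊤) (u v w : X Ω) : |bstar u v w| ≤
    (1 + embeddingConst Ω) * (normL4 u + ‖divg u‖) * ‖grad w‖ * normL4 v := by
  have hL := embeddingConst_nonneg Ω
  have hu := normL4_nonneg u
  have hv := normL4_nonneg v
  have hconv : |conv u w v| ≤ normL4 u * ‖grad w‖ * normL4 v := abs_conv_le u w v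
  have hdiv : |⟪divg u, dotL2 (toL4 v) (toL4 w)⟫_ℝ| ≤
      embeddingConst Ω * ‖divg u‖ * ‖grad w‖ * normL4 v :=
    calc |⟪divg u, dotL2 (toL4 v) (toL4 w)⟫_ℝ|
        ≤ ‖divg u‖ * ‖dotL2 (toL4 v) (toL4 w)‖ := abs_real_inner_le_norm _ _
      _ ≤ ‖divg u‖ * (normL4 v * normL4 w) := by
          rw [← norm_toL4 v, ← norm_toL4 w]
          gcongr
          exact norm_dotL2_le _ _
      _ ≤ ‖divg u‖ * (normL4 v * (embeddingConst Ω * ‖grad w‖)) := by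
          gcongr
          exact normL4_le_mul_norm_grad hΩ w
      _ = _ := by ring
  have hrest : 0 ≤ (embeddingConst Ω * normL4 u + (1 + embeddingConst Ω / 2) * ‖divg u‖) *
      ‖grad w‖ * normL4 v := by positivity
  rw [bstar_eq]
  rw [abs_le] at hconv hdiv ⊢
  constructor <;> linarith

theorem mul_normL4_sq_le {h c : ℝ} (hh : 0 ≤ h) {v : X Ω} (hv : h * ‖grad v‖ ≤ c * ‖val v‖) :
    h * normL4 v ^ 2 ≤ 2 * sobolevConst * c * ‖val v‖ ^ 2 :=
  calc h * normL4 v ^ 2 ≤ h * (2 * sobolevConst * (‖val v‖ * ‖grad v‖)) := by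
        gcongr
        exact normL4_sq_le v
    _ = 2 * sobolevConst * ‖val v‖ * (h * ‖grad v‖) := by ring
    _ ≤ 2 * sobolevConst * ‖val v‖ * (c * ‖val v‖) := by gcongr
    _ = 2 * sobolevConst * c * ‖val v‖ ^ 2 := by ring

/-- The interpolation `‖v‖²_{L⁴} ≤ 2 S ‖v‖ ‖∇v‖` costs only one power of `‖∇v‖`, which is why a
single factor `h` suffices here. -/
theorem exists_mul_bstar_sq_le (hΩ : volume Ω ≠ ⊤) (c : ℝ) :
    ∃ K : ℝ, 0 < K ∧ ∀ (h : ℝ) (u v w : X Ω), 0 ≤ h → h * ‖grad v‖ ≤ c * ‖val v‖ →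
      h * bstar u v w ^ 2 ≤
        K * (normL4 u + ‖divg u‖) ^ 2 * ‖grad w‖ ^ 2 * ‖val v‖ ^ 2 := by
  set L := embeddingConst Ω
  refine ⟨max 1 ((1 + L) ^ 2 * (2 * sobolevConst * c)), by positivity, fun h u v w hh hv => ?_⟩
  calc h * bstar u v w ^ 2
      ≤ h * ((1 + L) * (normL4 u + ‖divg u‖) * ‖grad w‖ * normL4 v) ^ 2 := by
        rw [← sq_abs (bstar u v w)]
        gcongr
        exact abs_bstar_le hΩ u v w
    _ = ((1 + L) * (normL4 u + ‖divg u‖) * ‖grad w‖) ^ 2 * (h * normL4 v ^ 2) := by ring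
    _ ≤ ((1 + L) * (normL4 u + ‖divg u‖) * ‖grad w‖) ^ 2 *
          (2 * sobolevConst * c * ‖val v‖ ^ 2) :=
        mul_le_mul_of_nonneg_left (mul_normL4_sq_le hh hv) (sq_nonneg _)
    _ = (1 + L) ^ 2 * (2 * sobolevConst * c) *
          (normL4 u + ‖divg u‖) ^ 2 * ‖grad w‖ ^ 2 * ‖val v‖ ^ 2 := by ring
    _ ≤ _ := by
        gcongr
        exact le_max_right _ _

end SkewForm

section DualNorm

variable {Ω : Set Plane}

theorem norm_le_mul_norm_grad (hΩ : volume Ω ≠ ⊤) (v : X Ω) :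
    ‖v‖ ≤ max (sobolevConst * √(volume.real Ω)) 1 * ‖grad v‖ := by
  rw [max_mul_of_nonneg _ _ (norm_nonneg _), one_mul]
  exact max_le_max (norm_val_le hΩ v) le_rfl

theorem apply_le_dualNorm_mul (hΩ : volume Ω ≠ ⊤) (f : X Ω →L[ℝ] ℝ) (v : X Ω) :
    f v ≤ dualNorm f * ‖grad v‖ := by
  set P := max (sobolevConst * √(volume.real Ω)) 1
  have hP (w : X Ω) : ‖w‖ ≤ P * ‖grad w‖ := norm_le_mul_norm_grad hΩ w
  rcases eq_or_ne v 0 with rfl | hv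
  · have hgrad : grad (0 : X Ω) = 0 := rfl
    rw [map_zero, hgrad, norm_zero, mul_zero]
  have hbdd : BddAbove {r | ∃ w : X Ω, w ≠ 0 ∧ r = f w / ‖grad w‖} := by
    refine ⟨‖f‖ * P, ?_⟩
    rintro r ⟨w, -, rfl⟩
    refine div_le_of_le_mul₀ (norm_nonneg _) (by positivity) ?_
    calc f w ≤ ‖f‖ * ‖w‖ := (le_abs_self _).trans (f.le_opNorm w)
      _ ≤ ‖f‖ * (P * ‖grad w‖) := by gcongr; exact hP w
      _ = ‖f‖ * P * ‖grad w‖ := (mul_assoc _ _ _).symm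
  have hgrad : 0 < ‖grad v‖ :=
    pos_of_mul_pos_right ((norm_pos_iff.2 hv).trans_le (hP v)) (by positivity)
  exact (div_le_iff₀ hgrad).1 (le_csSup hbdd ⟨v, hv, rfl⟩)

end DualNorm

section EnergyEstimate

theorem inner_blended_eq {E : Type*} [NormedAddCommGroup E] [InnerProductSpace ℝ E]
    (a b c d : E) :
    ⟪(10 : ℝ) • a - (15 : ℝ) • b + (6 : ℝ) • c - d, a⟫_ℝ / 6 =
      (‖a‖ ^ 2 + ‖(3 : ℝ) • a - b‖ ^ 2 + ‖(3 : ℝ) • a - (3 : ℝ) • b + c‖ ^ 2) / 12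
        - (‖b‖ ^ 2 + ‖(3 : ℝ) • b - c‖ ^ 2 + ‖(3 : ℝ) • b - (3 : ℝ) • c + d‖ ^ 2) / 12
        + ‖a - (3 : ℝ) • b + (3 : ℝ) • c - d‖ ^ 2 / 12 := by
  simp only [← real_inner_self_eq_norm_sq, inner_add_left, inner_sub_left, inner_add_right,
    inner_sub_right, real_inner_smul_left, real_inner_smul_right]
  rw [real_inner_comm a b, real_inner_comm a c, real_inner_comm a d, real_inner_comm b c,
    real_inner_comm b d, real_inner_comm c d]
  ring

theorem mul_le_mul_sq_add_mul_sq_of_le_mul {ν τ φ F g : ℝ} (hν : 0 < ν) (hτ : 0 ≤ τ)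
    (hφ : φ ≤ F * g) :
    τ * φ ≤ τ / ν * F ^ 2 + τ / 4 * (ν * g ^ 2) := by
  have hsq : 0 ≤ τ / ν * (F - ν * g / 2) ^ 2 := by positivity
  calc τ * φ ≤ τ * (F * g) := by gcongr
    _ ≤ τ * (F * g) + τ / ν * (F - ν * g / 2) ^ 2 := le_add_of_nonneg_right hsq
    _ = τ / ν * F ^ 2 + τ / 4 * (ν * g ^ 2) := by
      field_simp
      ring

theorem mul_le_mul_sq_add_of_mul_sq_le {ν τ h K M β g d : ℝ} (hν : 0 < ν) (hτ : 0 ≤ τ) (hh : 0 < h)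
    (hβ : h * β ^ 2 ≤ K * M ^ 2 * g ^ 2 * d ^ 2)
    (hcond : 12 * K * (τ / (ν * h)) * M ^ 2 ≤ 1) :
    τ * β ≤ τ / 2 * (ν * g ^ 2) + 1 / 24 * d ^ 2 := by
  have hK : 12 * K * τ * M ^ 2 ≤ ν * h := by
    rw [← div_le_one (by positivity)]
    exact (by ring : _ = _).trans_le hcond
  have hsq : h * (τ * β) ^ 2 ≤ h * (4 * (τ / 2 * (ν * g ^ 2)) * (1 / 24 * d ^ 2)) :=
    calc h * (τ * β) ^ 2 = τ ^ 2 * (h * β ^ 2) := by ring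
      _ ≤ τ ^ 2 * (K * M ^ 2 * g ^ 2 * d ^ 2) := by gcongr
      _ = 12 * K * τ * M ^ 2 * (τ * g ^ 2 * d ^ 2 / 12) := by ring
      _ ≤ ν * h * (τ * g ^ 2 * d ^ 2 / 12) := by gcongr
      _ = _ := by ring
  refine le_of_sq_le_sq ?_ (by positivity)
  exact (le_of_mul_le_mul_left hsq hh).trans (four_mul_le_sq_add _ _)

theorem add_sum_Ico_le_sum_Ico_add {R : Type*} [AddCommMonoid R] [Preorder R] [AddLeftMono R]
    {E a b : ℕ → R} {m N : ℕ} (hmN : m ≤ N)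
    (hstep : ∀ n, m ≤ n → n < N → E (n + 1) + a n ≤ b n + E n) :
    E N + ∑ n ∈ Finset.Ico m N, a n ≤ ∑ n ∈ Finset.Ico m N, b n + E m := by
  induction N, hmN using Nat.le_induction with
  | base => simp
  | succ N hmN ih =>
    rw [Finset.sum_Ico_succ_top hmN, Finset.sum_Ico_succ_top hmN]
    calc E (N + 1) + (∑ n ∈ Finset.Ico m N, a n + a N)
        = E (N + 1) + a N + ∑ n ∈ Finset.Ico m N, a n := by abel
      _ ≤ b N + E N + ∑ n ∈ Finset.Ico m N, a n :=
          add_le_add (hstep N hmN N.lt_succ_self) le_rfl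
      _ = b N + (E N + ∑ n ∈ Finset.Ico m N, a n) := add_assoc _ _ _
      _ ≤ b N + (∑ n ∈ Finset.Ico m N, b n + E m) :=
          add_le_add le_rfl (ih fun n hmn hnN => hstep n hmn (hnN.trans N.lt_succ_self))
      _ = ∑ n ∈ Finset.Ico m N, b n + b N + E m := by abel

variable {Ω : Set Plane}

/-- The third difference `wⁿ⁺¹ - 3 wⁿ + 3 wⁿ⁻¹ - wⁿ⁻²`, which measures the numerical dissipation
of the blended scheme (used for `n ≥ 2` only). -/
noncomputable def thirdDiff (w : ℕ → X Ω) (n : ℕ) : X Ω :=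
  w (n + 1) - (3 : ℝ) • w n + (3 : ℝ) • w (n - 1) - w (n - 2)

theorem extrap_eq_sub_thirdDiff (w : ℕ → X Ω) (n : ℕ) :
    extrap w n = w (n + 1) - thirdDiff w n := by
  rw [extrap, thirdDiff]
  abel

theorem val_add (v w : X Ω) : val (v + w) = val v + val w := rfl

theorem val_sub (v w : X Ω) : val (v - w) = val v - val w := rfl

theorem val_smul (c : ℝ) (v : X Ω) : val (c • v) = c • val v := rfl

theorem mul_inner_blendedBDF {Δt : ℝ} (hΔt : Δt ≠ 0) (w : ℕ → X Ω) {n : ℕ} (hn : 1 ≤ n) :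
    Δt * ⟪val (blendedBDF Δt w n), val (w (n + 1))⟫_ℝ =
      energy w (n + 1) - energy w n + 1 / 12 * ‖val (thirdDiff w n)‖ ^ 2 := by
  have hpred : n + 1 - 2 = n - 1 := by omega
  have hscale : Δt * (1 / (6 * Δt)) = 1 / 6 := by field_simp
  simp only [blendedBDF, energy, extrap, thirdDiff, val_add, val_sub, val_smul,
    Nat.add_sub_cancel, hpred, real_inner_smul_left]
  rw [← mul_assoc, hscale]
  linarith [inner_blended_eq (val (w (n + 1))) (val (w n)) (val (w (n - 1))) (val (w (n - 2)))]

namespace IsDiscreteSolution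

variable {Xh : Submodule ℝ (X Ω)} {Qh : Submodule ℝ (L2 ℝ Ω)} {ν Δt : ℝ} {J : ℕ}
  {f : Fin J → ℕ → X Ω →L[ℝ] ℝ} {N : ℕ} {u : Fin J → ℕ → X Ω} {p : Fin J → ℕ → L2 ℝ Ω}

theorem thirdDiff_mem (hsol : IsDiscreteSolution Xh Qh ν Δt f N u p) (j : Fin J) {n : ℕ}
    (hn : n < N) : thirdDiff (u j) n ∈ Xh := by
  have hmem : ∀ m ≤ N, u j m ∈ Xh := hsol.velocity_mem j
  exact Xh.sub_mem (Xh.add_mem (Xh.sub_mem (hmem _ hn) (Xh.smul_mem _ (hmem _ hn.le)))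
    (Xh.smul_mem _ (hmem _ (by omega)))) (hmem _ (by omega))

theorem inner_pressure_divg (hsol : IsDiscreteSolution Xh Qh ν Δt f N u p) (j : Fin J) {n : ℕ}
    (hn : 2 ≤ n) (hnN : n < N) : ⟪p j (n + 1), divg (u j (n + 1))⟫_ℝ = 0 := by
  rw [real_inner_comm]
  exact hsol.incompressible j n hn hnN _ (hsol.pressure_mem j n hn hnN)

/-- Test with `uⁿ⁺¹`; the extrapolation differs from it by the third difference, and both forms
vanish when their last two arguments agree. -/
theorem energy_balance (hsol : IsDiscreteSolution Xh Qh ν Δt f N u p) (hΔt : Δt ≠ 0) (j : Fin J)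
    {n : ℕ} (hn : 2 ≤ n) (hnN : n < N) :
    energy (u j) (n + 1) - energy (u j) n + 1 / 12 * ‖val (thirdDiff (u j) n)‖ ^ 2
        + Δt * (ν * ‖grad (u j (n + 1))‖ ^ 2) =
      Δt * f j (n + 1) (u j (n + 1))
        + Δt * bstar (fluct u j n) (thirdDiff (u j) n) (u j (n + 1)) := by
  have hmom := hsol.momentum j n hn hnN _ (hsol.velocity_mem j _ hnN)
  rw [bstar_self, extrap_eq_sub_thirdDiff, bstar_sub_middle, bstar_self,
    hsol.inner_pressure_divg j hn hnN, real_inner_self_eq_norm_sq] at hmom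
  rw [← mul_inner_blendedBDF hΔt (u j) (one_le_two.trans hn), ← hmom]
  ring

theorem energy_step (hsol : IsDiscreteSolution Xh Qh ν Δt f N u p) (hΩ : volume Ω ≠ ⊤)
    (hν : 0 < ν) (hΔt : 0 < Δt) {h K : ℝ} (hh : 0 < h) (j : Fin J) {n : ℕ}
    (hn : 2 ≤ n) (hnN : n < N)
    (hK : h * bstar (fluct u j n) (thirdDiff (u j) n) (u j (n + 1)) ^ 2 ≤
      K * (normL4 (fluct u j n) + ‖divg (fluct u j n)‖) ^ 2 * ‖grad (u j (n + 1))‖ ^ 2 *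
        ‖val (thirdDiff (u j) n)‖ ^ 2)
    (hcond : 12 * K * (Δt / (ν * h)) * (normL4 (fluct u j n) + ‖divg (fluct u j n)‖) ^ 2 ≤ 1) :
    energy (u j) (n + 1) + (1 / 24 * ‖val (thirdDiff (u j) n)‖ ^ 2
        + Δt / 4 * (ν * ‖grad (u j (n + 1))‖ ^ 2)) ≤
      Δt / ν * dualNorm (f j (n + 1)) ^ 2 + energy (u j) n := by
  have hbalance := hsol.energy_balance hΔt.ne' j hn hnN
  have hforce := mul_le_mul_sq_add_mul_sq_of_le_mul hν hΔt.le
    (apply_le_dualNorm_mul hΩ (f j (n + 1)) (u j (n + 1)))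
  have hconv := mul_le_mul_sq_add_of_mul_sq_le hν hΔt.le hh hK hcond
  linarith

end IsDiscreteSolution

end EnergyEstimate

end EnsembleNS

theorem theorem2_general (Ω : Set Plane) (hΩ : volume Ω ≠ ⊤) (Cinv : ℝ) :
    ∃ C : ℝ, 0 < C ∧
      ∀ (h : ℝ) (Xh : Submodule ℝ (X Ω)) (Qh : Submodule ℝ (L2 ℝ Ω)),
        0 < h → InverseInequality Xh h Cinv →
      ∀ (ν Δt : ℝ) (J : ℕ) (f : Fin J → ℕ → X Ω →L[ℝ] ℝ) (N : ℕ)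
        (u : Fin J → ℕ → X Ω) (p : Fin J → ℕ → L2 ℝ Ω),
        0 < ν → 0 < Δt → 2 ≤ N → IsDiscreteSolution Xh Qh ν Δt f N u p →
        (∀ n, 2 ≤ n → n < N → ∀ j,
          C * (Δt / (ν * h)) * (normL4 (fluct u j n) + ‖divg (fluct u j n)‖) ^ 2 ≤ 1) →
        ∀ j,
          energy (u j) N
            + (1 / 24) * ∑ n ∈ Finset.Ico 2 N,
                ‖val (u j (n + 1) - (3 : ℝ) • u j n + (3 : ℝ) • u j (n - 1) - u j (n - 2))‖ ^ 2
            + (Δt / 4) * ∑ n ∈ Finset.Ico 2 N, ν * ‖grad (u j (n + 1))‖ ^ 2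
          ≤ ∑ n ∈ Finset.Ico 2 N, (Δt / ν) * dualNorm (f j (n + 1)) ^ 2 + energy (u j) 2 := by
  obtain ⟨K, hKpos, hK⟩ := exists_mul_bstar_sq_le hΩ Cinv
  refine ⟨12 * K, by positivity, ?_⟩
  intro h Xh Qh hh hinv ν Δt J f N u p hν hΔt hN hsol hcond j
  rw [add_assoc, Finset.mul_sum, Finset.mul_sum, ← Finset.sum_add_distrib]
  refine add_sum_Ico_le_sum_Ico_add hN fun n hn hnN => ?_
  exact hsol.energy_step hΩ hν hΔt hh j hn hnN
    (hK h _ _ _ hh.le (hinv _ (hsol.thirdDiff_mem j hnN))) (hcond n hn hnN j)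

theorem theorem2 (Ω : Set Plane) (hΩ : IsOpen Ω) (hΩb : Bornology.IsBounded Ω) (Cinv : ℝ) :
    ∃ C : ℝ, 0 < C ∧
      ∀ (h : ℝ) (Xh : Submodule ℝ (X Ω)) (Qh : Submodule ℝ (L2 ℝ Ω)),
        0 < h → InverseInequality Xh h Cinv → (Qh : Set (L2 ℝ Ω)) ⊆ Q Ω →
      ∀ (ν Δt : ℝ) (J : ℕ) (f : Fin J → ℕ → X Ω →L[ℝ] ℝ) (N : ℕ)
        (u : Fin J → ℕ → X Ω) (p : Fin J → ℕ → L2 ℝ Ω),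
        0 < ν → 0 < Δt → 2 < N → IsDiscreteSolution Xh Qh ν Δt f N u p →
        (∀ n, 2 ≤ n → n < N → ∀ j,
          C * (Δt / (ν * h)) * (normL4 (fluct u j n) + ‖divg (fluct u j n)‖) ^ 2 ≤ 1) →
        ∀ j,
          energy (u j) N
            + (1 / 24) * ∑ n ∈ Finset.Ico 2 N,
                ‖val (u j (n + 1) - (3 : ℝ) • u j n + (3 : ℝ) • u j (n - 1) - u j (n - 2))‖ ^ 2
            + (Δt / 4) * ∑ n ∈ Finset.Ico 2 N, ν * ‖grad (u j (n + 1))‖ ^ 2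
          ≤ ∑ n ∈ Finset.Ico 2 N, (Δt / ν) * dualNorm (f j (n + 1)) ^ 2 + energy (u j) 2 := by
  obtain ⟨C, hC, hstable⟩ := theorem2_general Ω hΩb.measure_lt_top.ne Cinv
  exact ⟨C, hC, fun h Xh Qh hh hinv _ ν Δt J f N u p hν hΔt hN =>
    hstable h Xh Qh hh hinv ν Δt J f N u p hν hΔt hN.le⟩
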